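/- For a group $G$ and a subset $S\subset G$, let $\langle\langle S\rangle\rangle$ be the normal subgroup generated by $S$. For $X\in G$ let $\|X\|_S\in\mathbb{N}_0\cup\{+\infty\}$ be the least $n\ge 0$ such that $X$ is a product of $n$ elements each of which is conjugate in $G$ to an element of $S\cup S^{-1}$ (so $\|1\|_S=0$), and $\|X\|_S=+\infty$ if $X\notin\langle\langle S\rangle\rangle$. Let ${\rm diam}(\|\cdot\|_S)$ be the least $N$ with $\|X\|_S\le N$ for all $X\in G$, or $+\infty$ if there is no such $N$, and set $$\Delta_\infty(G):=\sup\{{\rm diam}(\|\cdot\|_S)\mid S\subset G \text{ finite},\ \langle\langle S\rangle\rangle=G\},$$ with $\Delta_\infty(G)=-\infty$ if there is no such $S$. For a commutative ring $R$ let ${\rm Sp}_4(R)=\{A\in R^{4\times 4}\mid A^TJA=J\}$ with $J=\begin{pmatrix}0&I_2\\-I_2&0\end{pmatrix}$. Let $K$ be a field. 1. If $K=\mathbb{F}_2$ is the field with two elements, then $\Delta_\infty({\rm Sp}_4(K))\le 5$. 2. If $K=\mathbb{F}_4$ is the field with four elements, then $\Delta_\infty({\rm Sp}_4(K))\le 4$.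 -/

import Mathlib

open scoped Pointwise

/-- The conjugation-invariant word norm `‖X‖_S`: the least number of factors in an expression of
`X` as a product of conjugates of elements of `S ∪ S⁻¹` (the empty product being `1`), and `⊤` if
there is no such expression, i.e. if `X` is not in the normal closure of `S`. -/
noncomputable def conjWordNorm {G : Type*} [Group G] (S : Set G) (X : G) : ℕ∞ :=
  ⨅ (l : List G) (_ : (∀ a ∈ l, a ∈ Group.conjugatesOfSet (S ∪ S⁻¹)) ∧ l.prod = X),
    (l.length : ℕ∞)

/-- The ball `B_S(k) = {X ∈ G | ‖X‖_S ≤ k}`. -/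
def conjWordBall {G : Type*} [Group G] (S : Set G) (k : ℕ) : Set G :=
  {X | conjWordNorm S X ≤ (k : ℕ∞)}

/-- The diameter of `‖·‖_S`: the least `N` with `B_S(N) = G`, or `⊤` if there is no such `N`. -/
noncomputable def conjWordDiam {G : Type*} [Group G] (S : Set G) : ℕ∞ :=
  ⨅ (N : ℕ) (_ : conjWordBall S N = Set.univ), (N : ℕ∞)

/-- `Δ_∞(G)`: the supremum of the diameters of `‖·‖_S` over all finite subsets `S` of `G` that
normally generate `G`. It takes values in `ℕ ∪ {+∞} ∪ {-∞}`; the supremum of the empty set is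
`⊥`, which plays the role of `-∞`. -/
noncomputable def deltaInfty (G : Type*) [Group G] : WithBot ℕ∞ :=
  ⨆ (S : Set G) (_ : S.Finite ∧ Subgroup.normalClosure S = ⊤), ((conjWordDiam S : ℕ∞) : WithBot ℕ∞)

/-- `Sp₄(R)`: the `4 × 4` matrices over `R`, in `2 × 2` blocks of size `2`, that preserve the
standard alternating form. (Mathlib's form is given by the negative of the matrix with blocks
`0, I, -I, 0`, which defines the same group; its condition `A J Aᵀ = J` is equivalent to
`Aᵀ J A = J` by `SymplecticGroup.mem_iff'`.) -/
abbrev Sp4 (R : Type*) [CommRing R] : Type _ :=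
  Matrix.symplecticGroup (Fin 2) R

namespace Symp4

open Matrix

/-- Coordinate vectors for the four-dimensional symplectic space. -/
abbrev V (K : Type*) := Fin 2 ⊕ Fin 2 → K

section Form

variable {K : Type*}

/-- A vector from its coordinates with respect to `e₁, e₂, f₁, f₂`. -/
def vec (a b c d : K) : V K := Sum.elim ![a, b] ![c, d]

theorem eq_vec (x : V K) : x = vec (x (.inl 0)) (x (.inl 1)) (x (.inr 0)) (x (.inr 1)) := by
  ext i; rcases i with i | i <;> fin_cases i <;> rfl

@[simp] theorem vec_inl_zero (a b c d : K) : vec a b c d (.inl 0) = a := rfl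
@[simp] theorem vec_inl_one (a b c d : K) : vec a b c d (.inl 1) = b := rfl
@[simp] theorem vec_inr_zero (a b c d : K) : vec a b c d (.inr 0) = c := rfl
@[simp] theorem vec_inr_one (a b c d : K) : vec a b c d (.inr 1) = d := rfl

theorem vec_ext {x y : V K} (h1 : x (.inl 0) = y (.inl 0)) (h2 : x (.inl 1) = y (.inl 1))
    (h3 : x (.inr 0) = y (.inr 0)) (h4 : x (.inr 1) = y (.inr 1)) : x = y := by
  rw [eq_vec x, eq_vec y, h1, h2, h3, h4]

variable [Field K]

/-- The standard alternating form in characteristic two. -/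
def form (x y : V K) : K :=
  x (.inl 0) * y (.inr 0) + x (.inl 1) * y (.inr 1) +
    x (.inr 0) * y (.inl 0) + x (.inr 1) * y (.inl 1)

theorem form_add_left (x y z : V K) : form (x + y) z = form x z + form y z := by
  simp only [form, Pi.add_apply]; ring

theorem form_add_right (x y z : V K) : form x (y + z) = form x y + form x z := by
  simp only [form, Pi.add_apply]; ring

theorem form_smul_left (c : K) (x y : V K) : form (c • x) y = c * form x y := by
  simp only [form, Pi.smul_apply, smul_eq_mul]; ring

theorem form_smul_right (c : K) (x y : V K) : form x (c • y) = c * form x y := by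
  simp only [form, Pi.smul_apply, smul_eq_mul]; ring

theorem form_comm (x y : V K) : form x y = form y x := by
  simp only [form]; ring

theorem vec_add (a b c d a' b' c' d' : K) :
    vec a b c d + vec a' b' c' d' = vec (a + a') (b + b') (c + c') (d + d') := by
  ext i; rcases i with i | i <;> fin_cases i <;> rfl

theorem smul_vec (k a b c d : K) : k • vec a b c d = vec (k * a) (k * b) (k * c) (k * d) := by
  ext i; rcases i with i | i <;> fin_cases i <;> rfl

theorem eq_of_form_eq {x y : V K} (h : ∀ z, form x z = form y z) : x = y := by
  refine vec_ext ?_ ?_ ?_ ?_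
  · simpa [form] using h (vec 0 0 1 0)
  · simpa [form] using h (vec 0 0 0 1)
  · simpa [form] using h (vec 1 0 0 0)
  · simpa [form] using h (vec 0 1 0 0)

theorem exists_form_eq_one {x : V K} (hx : x ≠ 0) : ∃ y, form x y = 1 := by
  by_contra! h
  refine hx (eq_of_form_eq fun z => ?_)
  have h0 : form (0 : V K) z = 0 := by simp [form]
  rw [h0]
  by_contra hz
  exact h ((form x z)⁻¹ • z) (by rw [form_smul_right, inv_mul_cancel₀ hz])

end Form

section Action

variable {K : Type*} [Field K]

instance : MulAction (Sp4 K) (V K) where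
  smul g x := (g : Matrix _ _ K) *ᵥ x
  one_smul x := by change ((1 : Sp4 K) : Matrix _ _ K) *ᵥ x = x; simp
  mul_smul g h x := by
    change (g * h).1 *ᵥ x = g.1 *ᵥ (h.1 *ᵥ x)
    simp

theorem smul_def (g : Sp4 K) (x : V K) : g • x = (g : Matrix _ _ K) *ᵥ x := rfl

instance : DistribMulAction (Sp4 K) (V K) where
  smul_zero _ := Matrix.mulVec_zero _
  smul_add _ := Matrix.mulVec_add _

instance : SMulCommClass (Sp4 K) K (V K) where
  smul_comm _ _ _ := Matrix.mulVec_smul _ _ _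

theorem ext_smul {g h : Sp4 K} (H : ∀ x : V K, g • x = h • x) : g = h :=
  Subtype.ext (Matrix.mulVec_injective (funext H : g.1.mulVec = h.1.mulVec))

/-- Linear independence of two vectors. -/
def Indep (p q : V K) : Prop := p ≠ 0 ∧ ∀ c : K, q ≠ c • p

theorem Indep.symm {p q : V K} (h : Indep p q) : Indep q p := by
  refine ⟨fun h0 => h.2 0 (by rw [h0, zero_smul]), fun c hc => ?_⟩
  rcases eq_or_ne c 0 with rfl | h0
  · exact h.1 (by rw [hc, zero_smul])
  · exact h.2 c⁻¹ (by rw [hc, inv_smul_smul₀ h0])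

variable [CharP K 2]

theorem form_self (x : V K) : form x x = 0 := by
  have h2 : (2 : K) = 0 := CharTwo.two_eq_zero
  simp only [form]
  linear_combination (x (.inl 0) * x (.inr 0) + x (.inl 1) * x (.inr 1)) * h2

theorem form_eq_dotProduct (x y : V K) : form x y = x ⬝ᵥ (J (Fin 2) K *ᵥ y) := by
  simp [form, J, dotProduct, Matrix.mulVec, Fintype.sum_sum_type, Matrix.one_apply,
    CharTwo.neg_eq]
  ring

theorem form_smul_smul (g : Sp4 K) (x y : V K) : form (g • x) (g • y) = form x y := by
  rw [form_eq_dotProduct, form_eq_dotProduct, smul_def, smul_def, Matrix.mulVec_mulVec,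
    Matrix.dotProduct_mulVec, Matrix.vecMul_mulVec, ← Matrix.dotProduct_mulVec,
    ← Matrix.mul_assoc, SymplecticGroup.mem_iff'.1 g.2]

/-- The element of `Sp₄` given by a linear map preserving the form. -/
def ofLinear (f : V K →ₗ[K] V K) (h : ∀ x y, form (f x) (f y) = form x y) : Sp4 K :=
  ⟨LinearMap.toMatrix' f, by
    rw [SymplecticGroup.mem_iff']
    refine Matrix.ext_iff_mulVec.2 fun y => dotProduct_eq _ _ fun x => ?_
    rw [dotProduct_comm, dotProduct_comm _ x, ← form_eq_dotProduct, ← h x y, form_eq_dotProduct,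
      Matrix.mul_assoc, ← Matrix.mulVec_mulVec, ← Matrix.mulVec_mulVec, Matrix.dotProduct_mulVec,
      Matrix.vecMul_transpose, LinearMap.toMatrix'_mulVec, LinearMap.toMatrix'_mulVec]⟩

theorem ofLinear_smul (f : V K →ₗ[K] V K) (h : ∀ x y, form (f x) (f y) = form x y) (x : V K) :
    ofLinear f h • x = f x :=
  LinearMap.toMatrix'_mulVec f x

/-- The transvection `x ↦ x + ω(x, v) v`. -/
def transvection (v : V K) : Sp4 K :=
  ofLinear
    { toFun := fun x => x + form x v • v
      map_add' := fun x y => by rw [form_add_left, add_smul]; abel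
      map_smul' := fun c x => by rw [form_smul_left, mul_smul, ← smul_add, RingHom.id_apply] }
    fun x y => by
      simp only [LinearMap.coe_mk, AddHom.coe_mk, form_add_left, form_add_right, form_smul_left,
        form_smul_right, form_self, form_comm v y]
      linear_combination (form x v * form y v) * (CharTwo.two_eq_zero : (2 : K) = 0)

theorem transvection_smul (v x : V K) : transvection v • x = x + form x v • v :=
  ofLinear_smul _ _ x

theorem transvection_zero : transvection (0 : V K) = 1 :=
  ext_smul fun x => by rw [transvection_smul, smul_zero, add_zero, one_smul]

theorem transvection_mul_self (v : V K) : transvection v * transvection v = 1 :=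
  ext_smul fun x => by
    rw [mul_smul, transvection_smul, transvection_smul, form_add_left, form_smul_left, form_self,
      mul_zero, add_zero, one_smul, add_assoc, ← add_smul, CharTwo.add_self_eq_zero, zero_smul,
      add_zero]

theorem transvection_inv (v : V K) : (transvection v)⁻¹ = transvection v :=
  inv_eq_of_mul_eq_one_left (transvection_mul_self v)

theorem conj_transvection (g : Sp4 K) (v : V K) :
    g * transvection v * g⁻¹ = transvection (g • v) := by
  rw [mul_inv_eq_iff_eq_mul]
  refine ext_smul fun x => ?_
  rw [mul_smul, mul_smul, transvection_smul, transvection_smul, form_smul_smul, smul_add,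
    smul_comm]

/-- Vectors `p, q, r, s` form a symplectic basis, in the order `e₁, e₂, f₁, f₂`. -/
structure IsBasis (p q r s : V K) : Prop where
  pq : form p q = 0
  pr : form p r = 1
  ps : form p s = 0
  qr : form q r = 0
  qs : form q s = 1
  rs : form r s = 0

/-- The element of `Sp₄` with prescribed images of the standard symplectic basis. -/
theorem IsBasis.exists_smul {p q r s : V K} (h : IsBasis p q r s) :
    ∃ g : Sp4 K, ∀ a b c d : K, g • vec a b c d = a • p + b • q + c • r + d • s := by
  refine ⟨ofLinear
    { toFun := fun x => x (.inl 0) • p + x (.inl 1) • q + x (.inr 0) • r + x (.inr 1) • s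
      map_add' := fun x y => by simp only [Pi.add_apply, add_smul]; abel
      map_smul' := fun c x => by
        simp only [Pi.smul_apply, smul_eq_mul, mul_smul, smul_add, RingHom.id_apply] }
    fun x y => ?_, fun a b c d => ofLinear_smul _ _ _⟩
  simp only [LinearMap.coe_mk, AddHom.coe_mk, form_add_left, form_add_right, form_smul_left,
    form_smul_right, form_self, form_comm q p, form_comm r p, form_comm s p, form_comm r q,
    form_comm s q, form_comm s r, h.pq, h.pr, h.ps, h.qr, h.qs, h.rs]
  simp only [form]
  ring

/-- A vector together with a vector pairing to one with it can be completed, the second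
hyperbolic pair starting with any given nonzero vector orthogonal to them. -/
theorem exists_isBasis_of_ne_zero {p q r : V K} (hpr : form p r = 1) (hpq : form p q = 0)
    (hqr : form q r = 0) (hq : q ≠ 0) : ∃ s, IsBasis p q r s := by
  obtain ⟨s, hs⟩ := exists_form_eq_one hq
  refine ⟨s + form s r • p + form s p • r, hpq, hpr, ?_, hqr, ?_, ?_⟩ <;>
  simp only [form_add_right, form_smul_right, form_self, hpr, hqr, hs, form_comm q p, hpq,
    form_comm r s, form_comm r p, form_comm p s, mul_zero, mul_one, add_zero,
    CharTwo.add_self_eq_zero]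

theorem exists_isBasis {p r : V K} (hpr : form p r = 1) : ∃ q s, IsBasis p q r s := by
  let f : V K →ₗ[K] K × K :=
    { toFun := fun x => (form x p, form x r)
      map_add' := fun x y => by simp only [form_add_left, Prod.mk_add_mk]
      map_smul' := fun c x => by
        simp only [form_smul_left, Prod.smul_mk, smul_eq_mul, RingHom.id_apply] }
  have hf : LinearMap.ker f ≠ ⊥ := LinearMap.ker_ne_bot_of_finrank_lt (by simp)
  obtain ⟨q, hq, hq0⟩ := Submodule.exists_mem_ne_zero_of_ne_bot hf
  have hq' : form q p = 0 ∧ form q r = 0 := Prod.mk.inj (LinearMap.mem_ker.1 hq)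
  obtain ⟨s, hs⟩ := exists_isBasis_of_ne_zero hpr ((form_comm p q).trans hq'.1) hq'.2 hq0
  exact ⟨q, s, hs⟩

theorem Indep.exists_form {p q : V K} (h : Indep p q) : ∃ s, form p s = 0 ∧ form q s = 1 := by
  obtain ⟨r, hr⟩ := exists_form_eq_one h.1
  by_contra! H
  refine h.2 (form q r) (eq_of_form_eq fun x => ?_)
  rw [form_smul_left]
  have h0 : form p (x + form p x • r) = 0 := by
    rw [form_add_right, form_smul_right, hr, mul_one, CharTwo.add_self_eq_zero]
  have h1 : form q (x + form p x • r) = 0 := by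
    by_contra hne
    refine H ((form q (x + form p x • r))⁻¹ • (x + form p x • r)) ?_ ?_
    · rw [form_smul_right, h0, mul_zero]
    · rw [form_smul_right, inv_mul_cancel₀ hne]
  rw [form_add_right, form_smul_right] at h1
  rw [CharTwo.add_eq_zero.1 h1, mul_comm]

/-- Two independent orthogonal vectors are the first half of a symplectic basis. -/
theorem Indep.exists_isBasis {p q : V K} (h : Indep p q) (hpq : form p q = 0) :
    ∃ r s, IsBasis p q r s := by
  obtain ⟨s, hps, hqs⟩ := h.exists_form
  obtain ⟨r, hqr, hpr⟩ := h.symm.exists_form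
  refine ⟨r + form r s • q, s, hpq, ?_, hps, ?_, hqs, ?_⟩ <;>
  simp only [form_add_right, form_add_left, form_smul_left, form_smul_right, hpr, hpq, hqr, hqs,
    form_self, mul_zero, mul_one, add_zero, CharTwo.add_self_eq_zero]

variable (K) in
/-- The reference involution, a product of two commuting transvections. -/
def refInvolution : Sp4 K := transvection (vec 1 0 0 0) * transvection (vec 0 1 0 0)

theorem isConj_refInvolution {p q : V K} (h : Indep p q) (hpq : form p q = 0) :
    IsConj (refInvolution K) (transvection p * transvection q) := by
  obtain ⟨r, s, hb⟩ := h.exists_isBasis hpq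
  obtain ⟨g, hg⟩ := hb.exists_smul
  refine isConj_iff.2 ⟨g, ?_⟩
  rw [refInvolution, ← conj_mul, conj_transvection, conj_transvection, hg, hg]
  simp

end Action

section NormalForm

variable {K : Type*} [Field K] [CharP K 2]

theorem IsBasis.eq_sum {p q r s : V K} (h : IsBasis p q r s) (x : V K) :
    x = form x r • p + form x s • q + form p x • r + form q x • s := by
  obtain ⟨g, hg⟩ := h.exists_smul
  obtain ⟨a, b, c, d, hx⟩ : ∃ a b c d : K, x = a • p + b • q + c • r + d • s := by
    have hx := congrArg (g • ·) (eq_vec (g⁻¹ • x))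
    simp only [hg, smul_inv_smul] at hx
    exact ⟨_, _, _, _, hx⟩
  subst hx
  simp only [form_add_left, form_add_right, form_smul_left, form_smul_right, form_self,
    form_comm q p, form_comm s r, h.pq, h.pr, h.ps, h.qr, h.qs, h.rs]
  simp

/-- The linear map sending `e₁ ↦ f₁`, `f₁ ↦ e₁ + w e₂ + a f₁`, and acting on `⟨e₂, f₂⟩` by the matrix
with rows `(b, c)` and `(d, e)`, up to the multiples of `f₁` forced by invariance of the form. -/
def normalMap (w a b c d e : K) (x : V K) : V K :=
  vec (x (.inr 0)) (w * x (.inr 0) + (b * x (.inl 1) + c * x (.inr 1)))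
    (x (.inl 0) + a * x (.inr 0) + w * (d * x (.inl 1) + e * x (.inr 1)))
    (d * x (.inl 1) + e * x (.inr 1))

theorem exists_basis_normal {X : Sp4 K} {p : V K} (hp : form p (X • p) = 1) :
    ∃ q s : V K, ∃ w a : K, (w = 0 ∨ w = 1) ∧ IsBasis p q (X • p) s ∧
      X • X • p = p + w • q + a • X • p := by
  set r := X • p with hr
  have hz : form r (X • r) = 1 := by rw [hr, form_smul_smul, ← hr, hp]
  set a := form p (X • r) with ha
  set u := X • r + p + a • r with hu
  have h1 : form p u = 0 := by
    rw [hu, form_add_right, form_add_right, form_smul_right, form_self, hp, ← ha, mul_one, add_zero,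
      CharTwo.add_self_eq_zero]
  have h2 : form u r = 0 := by
    rw [hu, form_add_left, form_add_left, form_smul_left, form_self, hp, form_comm, hz, mul_zero,
      add_zero, CharTwo.add_self_eq_zero]
  have h3 : X • r = p + u + a • r := by
    have h : ∀ y z : V K, y + z + z = y := fun y z => by
      ext i
      simp only [Pi.add_apply, add_assoc, CharTwo.add_self_eq_zero, add_zero]
    rw [hu, show p + (X • r + p + a • r) + a • r = X • r + p + p + a • r + a • r by abel, h, h]
  by_cases h0 : u = 0
  · obtain ⟨q, s, hb⟩ := exists_isBasis hp
    exact ⟨q, s, 0, a, Or.inl rfl, hb, by rw [h3, h0, zero_smul]⟩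
  · obtain ⟨s, hb⟩ := exists_isBasis_of_ne_zero hp h1 h2 h0
    exact ⟨u, s, 1, a, Or.inr rfl, hb, by rw [h3, one_smul]⟩

/-- An element `X` with `ω(v, X v) ≠ 0` for some `v` is conjugate to one in normal form. -/
theorem exists_normalForm (hsq : ∀ c : K, ∃ d, d * d = c) {X : Sp4 K} {v : V K}
    (hv : form v (X • v) ≠ 0) :
    ∃ (g : Sp4 K) (w a b c d e : K), (w = 0 ∨ w = 1) ∧ b * e + c * d = 1 ∧
      ∀ x : V K, X • g • x = g • normalMap w a b c d e x := by
  obtain ⟨k, hk⟩ := hsq (form v (X • v))⁻¹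
  have hp : form (k • v) (X • (k • v)) = 1 := by
    rw [smul_comm, form_smul_left, form_smul_right, ← mul_assoc, hk, inv_mul_cancel₀ hv]
  generalize k • v = p at hp
  obtain ⟨q, s, w, a, hw, hb, hX⟩ := exists_basis_normal hp
  set r := X • p with hr
  obtain ⟨g, hg⟩ := hb.exists_smul
  have key : ∀ x, form p x = 0 → form r x = 0 →
      X • x = form (X • x) s • q + (w * form q (X • x)) • r + form q (X • x) • s := by
    intro x hpx hrx
    have h1 : form (X • x) r = 0 := by rw [hr, form_smul_smul, form_comm, hpx]
    have h2 : form (X • x) (p + w • q + a • r) = 0 := by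
      rw [← hX, form_smul_smul, form_comm, hrx]
    have h3 : form p (X • x) = w * form q (X • x) := by
      rw [form_add_right, form_add_right, form_smul_right, form_smul_right, h1, mul_zero,
        add_zero, form_comm _ p, form_comm _ q] at h2
      exact CharTwo.add_eq_zero.1 h2
    conv_lhs => rw [hb.eq_sum (X • x), h1, h3, zero_smul, zero_add]
  have hq := key q hb.pq ((form_comm _ _).trans hb.qr)
  have hs := key s hb.ps hb.rs
  have hdet := form_smul_smul X q s
  rw [hb.qs, hq, hs] at hdet
  set b := form (X • q) s
  set c := form (X • s) s
  set d := form q (X • q)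
  set e := form q (X • s)
  refine ⟨g, w, a, b, c, d, e, hw, ?_, fun x => ?_⟩
  · simp only [form_add_left, form_add_right, form_smul_left, form_smul_right, form_self,
      form_comm r q, form_comm s q, form_comm s r, hb.qr, hb.qs, hb.rs] at hdet
    linear_combination hdet
  · have hx : g • x = _ := (congrArg (g • ·) (eq_vec x)).trans (hg _ _ _ _)
    rw [hx, normalMap, hg]
    simp only [smul_add, smul_comm X, hq, hs, ← hr, hX]
    clear_value r
    module

/-- An involution `X ≠ 1` with `ω(v, X v) = 0` for all `v` is unique up to conjugation. -/
theorem exists_basis_of_form_eq_zero {X : Sp4 K} (hX : X ≠ 1) (h : ∀ v : V K, form v (X • v) = 0) :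
    ∃ g : Sp4 K, ∀ x : V K, X • g • x =
      g • (vec (x (.inl 0)) (x (.inl 1)) (x (.inr 0) + x (.inl 1)) (x (.inr 1) + x (.inl 0))) := by
  obtain ⟨n, hn'⟩ : ∃ n : V K → V K, ∀ x, n x = X • x + x := ⟨_, fun _ => rfl⟩
  have hn : ∀ x, X • x = x + n x := fun x => by
    ext i
    rw [hn', Pi.add_apply, Pi.add_apply, add_left_comm, CharTwo.add_self_eq_zero, add_zero]
  have nadd : ∀ x y, n (x + y) = n x + n y := fun x y => by simp only [hn', smul_add]; abel
  have hform : ∀ x, form x (n x) = 0 := fun x => by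
    simp only [hn', form_add_right, form_self, h, add_zero]
  have hsym : ∀ x y, form (n x) y = form x (n y) := fun x y => by
    have := hform (x + y)
    rw [nadd, form_add_left, form_add_right, form_add_right, hform, hform, add_zero, zero_add,
      form_comm y] at this
    exact (CharTwo.add_eq_zero.1 this).symm
  have hnn : ∀ x, n (n x) = 0 := fun x => eq_of_form_eq fun z => by
    have h1 := form_smul_smul X x z
    rw [hn, hn, form_add_left, form_add_right, form_add_right, hsym x z] at h1
    rw [hsym]
    have h2 : form (n x) (n z) = 0 := by
      have h3 : form x (n z) + form x (n z) = 0 := CharTwo.add_self_eq_zero _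
      linear_combination h1 - h3
    rw [h2]; simp [form]
  obtain ⟨p, hp⟩ : ∃ p, n p ≠ 0 := by
    by_contra! H
    exact hX (ext_smul fun x => by rw [hn, H, add_zero, one_smul])
  obtain ⟨q, hq⟩ := exists_form_eq_one hp
  have hnq : form p (n q) = 1 := by rw [← hsym, hq]
  have hnpq : form (n p) (n q) = 0 := by rw [hsym, hnn]; simp [form]
  have nsmul : ∀ (c : K) x, n (c • x) = c • n x := fun c x => by
    simp only [hn', smul_add, smul_comm X]
  have hb : IsBasis p (q + form p q • n q) (n q) (n p) := by
    constructor <;>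
    simp only [form_add_right, form_add_left, form_smul_left, form_smul_right, form_self, hnq,
      hform, hq, hnpq, form_comm q (n p), form_comm (n q) (n p), mul_one,
      mul_zero, add_zero, CharTwo.add_self_eq_zero]
  obtain ⟨g, hg⟩ := hb.exists_smul
  refine ⟨g, fun x => ?_⟩
  have hx : g • x = _ := (congrArg (g • ·) (eq_vec x)).trans (hg _ _ _ _)
  rw [hx, hg, hn]
  simp only [nadd, nsmul, hnn]
  module

end NormalForm

section Commutator

variable {K : Type*} [Field K]

theorem Indep.smul {p q : V K} (h : Indep p q) (g : Sp4 K) : Indep (g • p) (g • q) :=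
  ⟨fun h0 => h.1 ((smul_eq_zero_iff_eq g).1 h0), fun c hc => h.2 c (by
    rw [← smul_comm] at hc
    exact MulAction.injective g hc)⟩

variable [CharP K 2]

theorem isConj_commutator_transvection {X : Sp4 K} {v : V K} (hv : form (X • v) v = 0)
    (hi : Indep v (X • v)) : ∃ g, IsConj (refInvolution K) (X * (g * X⁻¹ * g⁻¹)) := by
  refine ⟨transvection v, ?_⟩
  rw [transvection_inv, ← mul_assoc, ← mul_assoc, conj_transvection]
  exact isConj_refInvolution hi.symm hv

theorem IsBasis.ext_smul {p q r s : V K} (hb : IsBasis p q r s) {X Y : Sp4 K}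
    (hp : X • p = Y • p) (hq : X • q = Y • q) (hr : X • r = Y • r) (hs : X • s = Y • s) : X = Y :=
  Symp4.ext_smul fun x => by
    rw [hb.eq_sum x]
    simp only [smul_add, smul_comm X, smul_comm Y, hp, hq, hr, hs]

theorem IsBasis.exists_smul_eq {p q r s p' q' r' s' : V K} (hb : IsBasis p q r s)
    (hb' : IsBasis p' q' r' s') :
    ∃ g : Sp4 K, g • p = p' ∧ g • q = q' ∧ g • r = r' ∧ g • s = s' := by
  obtain ⟨g, hg⟩ := hb.exists_smul
  obtain ⟨h, hh⟩ := hb'.exists_smul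
  have key : ∀ a b c d : K,
      (h * g⁻¹) • (a • p + b • q + c • r + d • s) = a • p' + b • q' + c • r' + d • s' := by
    intro a b c d
    rw [← hg, mul_smul, inv_smul_smul, hh]
  refine ⟨h * g⁻¹, ?_, ?_, ?_, ?_⟩
  · simpa using key 1 0 0 0
  · simpa using key 0 1 0 0
  · simpa using key 0 0 1 0
  · simpa using key 0 0 0 1

theorem isConj_commutator_of_isBasis {X : Sp4 K} {p q r t : V K} {a : K}
    (hb : IsBasis p q r t) (hp : X • p = r) (hX : X • r = p + a • r) (hq : X • q = q)
    (ht : X • t = t) : ∃ g, IsConj (refInvolution K) (X * (g * X⁻¹ * g⁻¹)) := by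
  have hb' : IsBasis (p + q) q r (t + r) := by
    constructor <;>
    simp only [form_add_left, form_add_right, form_self, hb.pq,
      hb.pr, hb.ps, hb.qr, hb.qs, hb.rs, add_zero, zero_add, CharTwo.add_self_eq_zero]
  obtain ⟨g, gp, gq, gr, gt⟩ := hb.exists_smul_eq hb'
  have two : (2 : K) = 0 := CharTwo.two_eq_zero
  have key : X * g = transvection (p + r + a • r) * transvection (p + r + a • r + q) * (g * X) := by
    apply hb.ext_smul <;>
    simp only [mul_smul, transvection_smul, form_add_right, form_smul_left, form_smul_right,
      form_self, form_comm t r, form_comm r p, form_comm q p, form_comm r q,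
      form_comm t p, form_comm t q, hb.pq, hb.pr, hb.ps, hb.qr, hb.qs, hb.rs, hp, hX, hq, ht, gp,
      gq, gr, gt, smul_add, smul_comm g] <;>
    ext i <;>
    simp only [Pi.add_apply, Pi.smul_apply, smul_eq_mul] <;>
    grind
  have hconj : X * (g * X⁻¹ * g⁻¹) =
      transvection (p + r + a • r) * transvection (p + r + a • r + q) := by
    rw [← mul_assoc, ← mul_assoc, key]; group
  refine ⟨g, hconj ▸ isConj_refInvolution ⟨fun h0 => ?_, fun c hc => ?_⟩ ?_⟩
  · have := congrArg (form · r) h0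
    simp only [form_add_left, form_smul_left, form_self, hb.pr] at this
    simp [form] at this
  · have := congrArg (form · t) hc
    simp only [form_add_left, form_smul_left, hb.ps, hb.qs, hb.rs] at this
    simp at this
  · rw [form_add_right, form_self, zero_add]
    simp only [form_add_left, form_smul_left, form_comm r q, hb.pq, hb.qr, mul_zero, add_zero]

theorem isConj_commutator_of_search (hsq : ∀ c : K, ∃ d, d * d = c)
    (search : ∀ w a b c d e : K, (w = 0 ∨ w = 1) → b * e + c * d = 1 →
      (∃ v, form (normalMap w a b c d e v) v = 0 ∧ Indep v (normalMap w a b c d e v)) ∨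
      (w = 0 ∧ b = 1 ∧ c = 0 ∧ d = 0 ∧ e = 1) ∨ (w = 1 ∧ b = 1 ∧ d = 0 ∧ e = 1 ∧ a * c = 1))
    {X : Sp4 K} (hX : X ≠ 1) : ∃ g, IsConj (refInvolution K) (X * (g * X⁻¹ * g⁻¹)) := by
  by_cases h : ∃ v : V K, form v (X • v) ≠ 0
  · obtain ⟨v, hv⟩ := h
    obtain ⟨g, w, a, b, c, d, e, hw, hdet, hg⟩ := exists_normalForm hsq hv
    obtain ⟨v, h1, h2⟩ | ⟨rfl, rfl, rfl, rfl, rfl⟩ | ⟨rfl, rfl, rfl, rfl, hac⟩ :=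
      search w a b c d e hw hdet
    · refine isConj_commutator_transvection (v := g • v) ?_ ?_
      · rw [hg, form_smul_smul, h1]
      · rw [hg]; exact h2.smul g
    · refine isConj_commutator_of_isBasis (p := g • vec 1 0 0 0) (q := g • vec 0 1 0 0)
        (r := g • vec 0 0 1 0) (t := g • vec 0 0 0 1) (a := a) ?_ ?_ ?_ ?_ ?_
      · constructor <;> rw [form_smul_smul] <;> simp [form]
      all_goals
        rw [hg, normalMap]
        simp [smul_vec, vec_add, ← smul_comm g, ← smul_add]
    · have h2 : c + c = 0 := CharTwo.add_self_eq_zero c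
      refine isConj_commutator_of_isBasis (p := g • vec 1 c 0 0) (q := g • vec 0 1 0 0)
        (r := g • vec 0 c 1 0) (t := g • vec c 0 c 1) (a := a) ?_ ?_ ?_ ?_ ?_
      · constructor <;> rw [form_smul_smul] <;> simp [form, h2]
      all_goals
        rw [hg, normalMap]
        try rw [← smul_comm g, ← smul_add, smul_vec, vec_add]
        congr 1
        apply vec_ext <;> simp <;> grind
  · push Not at h
    obtain ⟨g, hg⟩ := exists_basis_of_form_eq_zero hX h
    refine isConj_commutator_transvection (v := g • vec 1 0 0 0) ?_ ?_
    · rw [form_comm, h]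
    · rw [hg]
      refine Indep.smul ⟨fun h0 => ?_, fun c hc => ?_⟩ g
      · simpa using congrFun h0 (.inl 0)
      · simpa using congrFun hc (.inr 1)

end Commutator

/-- The field with four elements. -/
inductive F4
  | zero | one | gen | genSq

namespace F4

instance : DecidableEq F4 := fun x y => by
  cases x <;> cases y <;> first | exact isTrue rfl | exact isFalse nofun

instance : Zero F4 := ⟨zero⟩

instance : One F4 := ⟨one⟩

instance : Add F4 := ⟨fun
  | zero, y => y
  | x, zero => x
  | one, one => zero
  | one, gen => genSq
  | one, genSq => gen
  | gen, one => genSq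
  | gen, gen => zero
  | gen, genSq => one
  | genSq, one => gen
  | genSq, gen => one
  | genSq, genSq => zero⟩

instance : Mul F4 := ⟨fun
  | zero, _ => zero
  | _, zero => zero
  | one, y => y
  | x, one => x
  | gen, gen => genSq
  | gen, genSq => one
  | genSq, gen => one
  | genSq, genSq => gen⟩

instance : Neg F4 := ⟨id⟩

instance : Inv F4 := ⟨fun
  | zero => zero
  | one => one
  | gen => genSq
  | genSq => gen⟩

instance : Fintype F4 where
  elems := {zero, one, gen, genSq}
  complete x := by cases x <;> decide

instance : CommRing F4 where
  add_assoc a b c := by cases a <;> cases b <;> cases c <;> rfl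
  zero_add a := by cases a <;> rfl
  add_zero a := by cases a <;> rfl
  add_comm a b := by cases a <;> cases b <;> rfl
  left_distrib a b c := by cases a <;> cases b <;> cases c <;> rfl
  right_distrib a b c := by cases a <;> cases b <;> cases c <;> rfl
  zero_mul a := by cases a <;> rfl
  mul_zero a := by cases a <;> rfl
  mul_assoc a b c := by cases a <;> cases b <;> cases c <;> rfl
  one_mul a := by cases a <;> rfl
  mul_one a := by cases a <;> rfl
  mul_comm a b := by cases a <;> cases b <;> rfl
  neg_add_cancel a := by cases a <;> rfl
  nsmul := nsmulRec
  zsmul := zsmulRec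

instance : Field F4 where
  exists_pair_ne := ⟨0, 1, by decide⟩
  mul_inv_cancel a ha := by
    cases a
    · exact absurd rfl ha
    all_goals rfl
  inv_zero := rfl
  nnqsmul := _
  qsmul := _

instance : CharP F4 2 := CharTwo.of_one_ne_zero_of_two_eq_zero (by decide) (by decide)

end F4

section Search

/-- Coordinate vectors as tuples. -/
abbrev Tup (K : Type*) := K × K × K × K

namespace Tup

variable {K : Type*} [Add K] [Mul K] [Zero K] [One K] [DecidableEq K]

/-- The alternating form on tuples. -/
def form : Tup K → Tup K → K
  | (a, b, c, d), (e, f, g, h) => a * g + b * h + c * e + d * f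

/-- The action of a transvection on tuples. -/
def tv (v x : Tup K) : Tup K :=
  match v, x, form x v with
  | (a, b, c, d), (a', b', c', d'), k => (a' + k * a, b' + k * b, c' + k * c, d' + k * d)

/-- `normalMap` on tuples. -/
def normal : K × K × K × K × K × K → Tup K → Tup K
  | (w, a, b, c, d, e), (x, y, z, t) =>
    (z, w * z + (b * y + c * t), x + a * z + w * (d * y + e * t), d * y + e * t)

/-- The hyperbolic involution on tuples. -/
def hyper : Tup K → Tup K
  | (x, y, z, t) => (x, y, z + y, t + x)

/-- Two tuples are orthogonal and independent. -/
def good (elts : List K) (p q : Tup K) : Bool :=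
  decide (form p q = 0) && !decide (p = (0, 0, 0, 0)) &&
    elts.all fun k => match p with
      | (a, b, c, d) => !decide (q = (k * a, k * b, k * c, k * d))

/-- Parameters of the normal forms. -/
def params (elts : List K) : List (K × K × K × K × K × K) :=
  [0, 1].flatMap fun w => elts.flatMap fun a => elts.flatMap fun b => elts.flatMap fun c =>
    elts.flatMap fun d => elts.flatMap fun e => if b * e + c * d = 1 then [(w, a, b, c, d, e)] else []

/-- All tuples. -/
def all (elts : List K) : List (Tup K) :=
  elts.flatMap fun a => elts.flatMap fun b => elts.flatMap fun c => elts.map fun d => (a, b, c, d)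

/-- The `i`-th tuple encoded in a number with digits in base `4`. -/
def decode (f : ℕ → K) (n i : ℕ) : Tup K :=
  (f (n / 4 ^ (4 * i + 3) % 4), f (n / 4 ^ (4 * i + 2) % 4), f (n / 4 ^ (4 * i + 1) % 4),
    f (n / 4 ^ (4 * i) % 4))

/-- The linear maps to be factorized. -/
def maps (elts : List K) : List (Tup K → Tup K) := hyper :: (params elts).map normal

/-- The map `g` is the product of five transvections, the first one subject to the
condition `P` and the others forming two orthogonal independent pairs. -/
def factors (elts : List K) (P : Tup K → Bool) (g : Tup K → Tup K) (t p q r s : Tup K) : Bool :=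
  P t && good elts p q && good elts r s &&
    [(1, 0, 0, 0), (0, 1, 0, 0), (0, 0, 1, 0), (0, 0, 0, 1)].all fun x =>
      decide (g x = tv t (tv p (tv q (tv r (tv s x)))))

/-- A list of numbers encodes factorizations of a list of maps. -/
def checkTable (elts : List K) (f : ℕ → K) (P : Tup K → Bool) :
    List (Tup K → Tup K) → List ℕ → Bool
  | [], _ => true
  | _ :: _, [] => false
  | g :: gs, n :: ns => factors elts P g (decode f n 4) (decode f n 3) (decode f n 2) (decode f n 1)
      (decode f n 0) && checkTable elts f P gs ns

/-- Normal forms of the elements fixing pointwise a hyperbolic plane. -/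
def exceptional : K × K × K × K × K × K → Bool
  | (w, a, b, c, d, e) =>
    decide (w = 0 ∧ b = 1 ∧ c = 0 ∧ d = 0 ∧ e = 1) ||
      decide (w = 1 ∧ b = 1 ∧ d = 0 ∧ e = 1 ∧ a * c = 1)

/-- Every normal form which is not exceptional moves some vector to an orthogonal independent
vector. -/
def checkSearch (elts : List K) : Bool :=
  (params elts).all fun x => exceptional x || (all elts).any fun v => good elts v (normal x v)

end Tup

/-- Numbering of the elements of `F4`. -/
def F4.ofDigit : ℕ → F4
  | 0 => .zero
  | 1 => .one
  | 2 => .gen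
  | _ => .genSq

open Tup

/-- The elements of `F4`. -/
def F4.elts : List F4 := [.zero, .one, .gen, .genSq]

theorem checkSearch_F4 : checkSearch F4.elts = true := by decide +kernel

theorem checkSearch_zmod_two : checkSearch (K := ZMod 2) [0, 1] = true := by decide +kernel

/-- Factorizations over `F4`. -/
def tableF4 : List ℕ :=
  [134283787, 1342510145, 2281771468, 2281902540, 2281837004, 1879454786, 2281845452, 2281779916,
   2281910988, 1611080771, 2281907148, 2281841612, 2281776076, 1174523087, 1157710917, 1157728395,
   1157745870, 1359287617, 2281771212, 2281902284, 2281836748, 1913009730, 2281779404, 2281910476,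
   2281844940, 1661413187, 2281775308, 2281906380, 2281840844, 2282824652, 2282758604, 2282954956,
   2282889932, 2281771980, 2281903052, 1376065089, 2281837516, 2281845196, 1929787202, 2281910732,
   2281779660, 2281906892, 2281775820, 2281841356, 1627858243, 2282828492, 2282762700, 2282959820,
   2282893516, 2281771724, 2281837260, 2281902796, 1392842561, 2281845708, 2281780172, 1896232258,
   2281911244, 2281906636, 1644635715, 2281775564, 2281841100, 570700612, 67178820, 67309892,
   67244356, 319037764, 67252804, 67187268, 67318340, 302264644, 67314500, 67248964, 67183428,
   67174724, 67240772, 67174980, 67175236, 537145412, 67178564, 67309636, 67244100, 268705860,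
   67186756, 67317828, 67252292, 268709956, 67182660, 67313732, 67248196, 285483844, 268706116,
   319037508, 302260804, 67179332, 67310404, 553923140, 67244868, 67252548, 302261060, 67318084,
   67187012, 67314244, 67183172, 67248708, 285487940, 285487684, 268710212, 319042372, 302264388,
   67179076, 67244612, 67310148, 587477316, 67253060, 67187524, 285483588, 67318596, 67313988,
   319042116, 67182916, 67248452, 571224900, 201396548, 201527620, 201462084, 319562052, 201470532,
   201404996, 201536068, 302788932, 201532228, 201466692, 201401156, 201392452, 201458500,
   201392708, 201392964, 537669700, 201396292, 201527364, 201461828, 269230148, 201404484,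
   201535556, 201470020, 269234244, 201400388, 201531460, 201465924, 286008132, 269230404,
   319561796, 302785092, 201397060, 201528132, 554447428, 201462596, 201470276, 302785348,
   201535812, 201404740, 201531972, 201400900, 201466436, 286012228, 286011972, 269234500,
   319566660, 302788676, 201396804, 201462340, 201527876, 588001604, 201470788, 201405252,
   286007876, 201536324, 201531716, 319566404, 201400644, 201466180, 570962756, 134287684,
   134418756, 134353220, 319299908, 134361668, 134296132, 134427204, 302526788, 134423364,
   134357828, 134292292, 134283588, 134349636, 134283844, 134284100, 537407556, 134287428,
   134418500, 134352964, 268968004, 134295620, 134426692, 134361156, 268972100, 134291524,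
   134422596, 134357060, 285745988, 268968260, 319299652, 302522948, 134288196, 134419268,
   554185284, 134353732, 134361412, 302523204, 134426948, 134295876, 134423108, 134292036,
   134357572, 285750084, 285749828, 268972356, 319304516, 302526532, 134287940, 134353476,
   134419012, 587739460, 134361924, 134296388, 285745732, 134427460, 134422852, 319304260,
   134291780, 134357316, 2368159485, 1140932689, 3338817361, 2248362577, 2786149982, 1141014706,
   2080775378, 1291914930, 4145104731, 1141096675, 1224805347, 1745295507, 335810628, 3642104761,
   3574014557, 2500211545, 940056644, 335810884, 2248297040, 3338882896, 335814724, 1292046000,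
   940053316, 940061252, 335818820, 1224870880, 738992964, 1409944620, 3523726300, 3405980902,
   3405915876, 3405850087, 1932081138, 940052804, 3338751827, 1140998227, 1778981203, 3909499785,
   1141080241, 738996804, 1661544386, 1140965602, 335815492, 1224936418, 2466680472, 2382509239,
   2382443958, 2382575540, 2737210293, 738988356, 1141063762, 2248231506, 1913468547, 1140949171,
   1291980467, 335819332, 2131565906, 3171364557, 940057412, 1141031137, 1090585937, 3439475943,
   1258359377, 1308692305, 1124272050, 1140990291, 738730564, 3826074220, 1107429091, 1141059922,
   3020505976, 940323652, 738730052, 1140920657, 1141051986, 1140986707, 2298620597, 4111078570,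
   2768573695, 4110750890, 738725956, 2231506926, 940315460, 1124140976, 940314692, 3305313979,
   1107363552, 738726468, 2770417101, 3171362905, 2667982556, 3993735063, 1308757843, 1090651475,
   1258424915, 3439410660, 2231440877, 336605508, 1141056338, 1124206513, 4244975350, 1140929361,
   2618107269, 3305248696, 2300914615, 3909499997, 738726724, 3657907096, 1258490450, 1090717010,
   2298554804, 1308823378, 2835692455, 1140925009, 2231572204, 3624482245, 3305182649, 336601412,
   1107494625, 1140994643, 3254922681, 1140929506, 939798852, 2385128685, 3238078557, 1140986849,
   3657905349, 336073284, 3271804643, 3456251743, 4211421020, 2265128887, 939798596, 1140925154,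
   1141056483, 1140990433, 939794500, 3254988730, 336081732, 336077380, 336076868, 939794756,
   1241647536, 3238209886, 3456185949, 2919902461, 4060753067, 2919574781, 3405913183, 3405848157,
   1862745488, 3405978974, 3875935626, 3254857400, 1142109171, 1140994785, 2467106650, 1241582001,
   1141052131, 1879454851, 2264997045, 2315439586, 3271673570, 3574147271, 2382442223, 2382573550,
   2064329426, 2382507500, 2517443418, 2854404829, 1141060067, 2013669457, 1241713075, 1140920802,
   3541300214, 3238144863, 2802134438, 2265063092, 3271739105, 2315374049, 2198026733, 1140925107,
   4012082860, 738468164, 2181203890, 2332239450, 3322026726, 2919578200, 2164341849, 1141052081,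
   336335684, 2667979909, 738467908, 1140929459, 1141060017, 1140994738, 738472004, 2197961455,
   336343876, 1477053460, 2332108633, 4212078761, 4211423401, 2735683838, 336343108, 738472260,
   2164407643, 1325600224, 3405855674, 3405920955, 3405986232, 3490302942, 3607704159, 3677304985,
   1812413521, 1140990386, 4127537655, 3322092516, 3472984497, 2181269425, 1325534690, 1140920755,
   2164473434, 2450694823, 2382567514, 2382437209, 2382502235, 2047224272, 3053917647, 2197896172,
   1141056433, 1142039202, 3321960677, 3473115571, 3037269397, 2181138355, 3523807839, 1325469153,
   1611080898, 1140986802]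

theorem checkTable_F4 :
    checkTable F4.elts F4.ofDigit (fun t => decide (t = 0)) (maps F4.elts) tableF4 = true := by
  decide +kernel

/-- Factorizations over the field with two elements. -/
def tableF2 : List ℕ :=
  [4362141957, 1342510145, 5637477441, 5452678213, 1157710917, 1359287617, 5654254913, 4362146116,
   67178820, 67174724, 4362142020, 4362145860, 67178564, 4647555140, 1140932689, 335810628,
   4647555396, 5435899984, 335810884, 1090585937, 4648407364, 5435887696, 1140920657, 336597060,
   5385553232]

theorem checkTable_zmod_two :
    checkTable (K := ZMod 2) [0, 1] (fun n => n) (fun _ => true) (maps [0, 1]) tableF2 = true := by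
  decide +kernel

end Search

section Bridge

variable {K : Type*} [Field K]

/-- The vector with the given coordinates. -/
def Tup.toV : Tup K → V K
  | (a, b, c, d) => vec a b c d

theorem Tup.toV_zero : (0 : Tup K).toV = 0 :=
  vec_ext rfl rfl rfl rfl

theorem Tup.normalMap_toV (w a b c d e : K) (x : Tup K) :
    normalMap w a b c d e x.toV = (Tup.normal (w, a, b, c, d, e) x).toV := rfl

theorem isBasis_std :
    IsBasis (vec 1 0 0 0 : V K) (vec 0 1 0 0) (vec 0 0 1 0) (vec 0 0 0 1) := by
  constructor <;> simp [form]

theorem Tup.tv_toV [CharP K 2] (v x : Tup K) : transvection v.toV • x.toV = (Tup.tv v x).toV := by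
  rw [transvection_smul]
  obtain ⟨a, b, c, d⟩ := v
  obtain ⟨a', b', c', d'⟩ := x
  exact vec_ext rfl rfl rfl rfl

variable [DecidableEq K]

theorem Tup.good_iff {elts : List K} (he : ∀ k, k ∈ elts) {p q : Tup K}
    (h : Tup.good elts p q = true) : Symp4.form p.toV q.toV = 0 ∧ Indep p.toV q.toV := by
  obtain ⟨a, b, c, d⟩ := p
  obtain ⟨a', b', c', d'⟩ := q
  simp only [Tup.good, Bool.and_eq_true, decide_eq_true_eq, Bool.not_eq_true', decide_eq_false_iff_not,
    List.all_eq_true] at h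
  obtain ⟨⟨h1, h2⟩, h3⟩ := h
  refine ⟨h1, fun h0 => h2 ?_, fun k hk => h3 k (he k) ?_⟩
  · exact Prod.ext (congrFun h0 (.inl 0)) (Prod.ext (congrFun h0 (.inl 1))
      (Prod.ext (congrFun h0 (.inr 0)) (congrFun h0 (.inr 1))))
  · exact Prod.ext (congrFun hk (.inl 0)) (Prod.ext (congrFun hk (.inl 1))
      (Prod.ext (congrFun hk (.inr 0)) (congrFun hk (.inr 1))))

theorem Tup.mem_params {elts : List K} (he : ∀ k, k ∈ elts) {w a b c d e : K} (hw : w = 0 ∨ w = 1)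
    (h : b * e + c * d = 1) : (w, a, b, c, d, e) ∈ Tup.params elts := by
  simp only [Tup.params, List.mem_flatMap]
  refine ⟨w, by simpa using hw, a, he a, b, he b, c, he c, d, he d, e, he e, ?_⟩
  rw [if_pos h]
  exact List.mem_singleton_self _

theorem search_of_checkSearch {elts : List K} (he : ∀ k, k ∈ elts)
    (h : Tup.checkSearch elts = true) (w a b c d e : K) (hw : w = 0 ∨ w = 1)
    (hdet : b * e + c * d = 1) :
    (∃ v, form (normalMap w a b c d e v) v = 0 ∧ Indep v (normalMap w a b c d e v)) ∨
      (w = 0 ∧ b = 1 ∧ c = 0 ∧ d = 0 ∧ e = 1) ∨ (w = 1 ∧ b = 1 ∧ d = 0 ∧ e = 1 ∧ a * c = 1) := by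
  have h1 := List.all_eq_true.1 h _ (Tup.mem_params he (a := a) hw hdet)
  rw [Bool.or_eq_true, List.any_eq_true, Tup.exceptional, Bool.or_eq_true, decide_eq_true_eq,
    decide_eq_true_eq] at h1
  rcases h1 with h1 | ⟨v, -, hv⟩
  · exact Or.inr h1
  · refine Or.inl ⟨v.toV, ?_⟩
    rw [form_comm, Tup.normalMap_toV]
    exact Tup.good_iff he hv

theorem exists_factors_of_checkTable {elts : List K} {f : ℕ → K} {P : Tup K → Bool} :
    ∀ {gs : List (Tup K → Tup K)} {ns : List ℕ}, Tup.checkTable elts f P gs ns = true →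
      ∀ g ∈ gs, ∃ t p q r s, Tup.factors elts P g t p q r s = true
  | [], _, _, _, hg => absurd hg List.not_mem_nil
  | _ :: _, [], h, _, _ => Bool.noConfusion h
  | g' :: gs, n :: ns, h, g, hg => by
    rw [Tup.checkTable, Bool.and_eq_true] at h
    rcases List.mem_cons.1 hg with rfl | hg
    · exact ⟨_, _, _, _, _, h.1⟩
    · exact exists_factors_of_checkTable h.2 g hg

variable [CharP K 2]

/-- Up to a transvection, `X` is a product of two conjugates of the reference involution. -/
def IsFactored (P : Tup K → Bool) (X : Sp4 K) : Prop :=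
  ∃ (g : Sp4 K) (t : Tup K) (A B : Sp4 K), P t = true ∧ IsConj (refInvolution K) A ∧
    IsConj (refInvolution K) B ∧ X = transvection (g • t.toV) * (A * B)

theorem isFactored_of_factors {elts : List K} (he : ∀ k, k ∈ elts) {P : Tup K → Bool}
    {φ : Tup K → Tup K} {t p q r s : Tup K} (h : Tup.factors elts P φ t p q r s = true)
    {X g : Sp4 K} (hX : ∀ x : Tup K, X • g • x.toV = g • (φ x).toV) : IsFactored P X := by
  simp only [Tup.factors, Bool.and_eq_true, List.all_eq_true, decide_eq_true_eq] at h
  obtain ⟨⟨⟨ht, hpq⟩, hrs⟩, hφ⟩ := h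
  obtain ⟨h1, h2⟩ := Tup.good_iff he hpq
  obtain ⟨h3, h4⟩ := Tup.good_iff he hrs
  have key : ∀ x : Tup K, x ∈ [((1, 0, 0, 0) : Tup K), (0, 1, 0, 0), (0, 0, 1, 0), (0, 0, 0, 1)] →
      (g⁻¹ * X * g) • x.toV = (transvection t.toV * ((transvection p.toV * transvection q.toV) *
        (transvection r.toV * transvection s.toV))) • x.toV := by
    intro x hx
    simp only [mul_smul, hX, inv_smul_smul, Tup.tv_toV, hφ x hx]
  have hY : g⁻¹ * X * g = _ :=
    isBasis_std.ext_smul (key (1, 0, 0, 0) (by simp)) (key (0, 1, 0, 0) (by simp))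
      (key (0, 0, 1, 0) (by simp)) (key (0, 0, 0, 1) (by simp))
  refine ⟨g, t, g * (transvection p.toV * transvection q.toV) * g⁻¹,
    g * (transvection r.toV * transvection s.toV) * g⁻¹, ht,
    (isConj_refInvolution h2 h1).trans (isConj_iff.2 ⟨g, rfl⟩),
    (isConj_refInvolution h4 h3).trans (isConj_iff.2 ⟨g, rfl⟩), ?_⟩
  rw [conj_mul, ← conj_transvection, conj_mul, ← hY]
  group

theorem isFactored_of_checkTable (hsq : ∀ c : K, ∃ d, d * d = c) {elts : List K}
    (he : ∀ k, k ∈ elts) {f : ℕ → K} {P : Tup K → Bool} (hP : P 0 = true) {ns : List ℕ}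
    (h : Tup.checkTable elts f P (Tup.maps elts) ns = true) (X : Sp4 K) : IsFactored P X := by
  have hmem := exists_factors_of_checkTable h
  by_cases hv : ∃ v : V K, form v (X • v) ≠ 0
  · obtain ⟨v, hv⟩ := hv
    obtain ⟨g, w, a, b, c, d, e, hw, hdet, hg⟩ := exists_normalForm hsq hv
    obtain ⟨t, p, q, r, s, hf⟩ := hmem _
      (List.mem_cons_of_mem _ (List.mem_map_of_mem (Tup.mem_params he (a := a) hw hdet)))
    exact isFactored_of_factors he hf fun x => hg x.toV
  · push Not at hv
    by_cases h1 : X = 1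
    · refine ⟨1, 0, transvection (vec 1 0 0 0) * transvection (vec 0 1 0 0),
        transvection (vec 0 1 0 0) * transvection (vec 1 0 0 0), hP, IsConj.refl _,
        isConj_refInvolution ⟨fun h0 => ?_, fun c hc => ?_⟩ ?_, ?_⟩
      · simpa using congrFun h0 (.inl 1)
      · simpa using congrFun hc (.inl 0)
      · simp [form]
      · rw [Tup.toV_zero, smul_zero, transvection_zero, one_mul, mul_assoc,
          ← mul_assoc (transvection (vec 0 1 0 0)), transvection_mul_self, one_mul,
          transvection_mul_self, h1]
    · obtain ⟨g, hg⟩ := exists_basis_of_form_eq_zero h1 hv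
      obtain ⟨t, p, q, r, s, hf⟩ := hmem _ List.mem_cons_self
      exact isFactored_of_factors he hf fun x => hg x.toV

end Bridge

section Covering

variable {G : Type*} [Group G]

/-- Every element is a product of at most `n` conjugates of `s` and `s⁻¹`. -/
def Covers (n : ℕ) (s : G) : Prop :=
  ∀ x : G, ∃ l : List G, l.length ≤ n ∧ (∀ a ∈ l, IsConj s a ∨ IsConj s⁻¹ a) ∧ l.prod = x

theorem Covers.of_mulEquiv {H : Type*} [Group H] (e : G ≃* H) {n : ℕ} {s : G}
    (h : Covers n (e s)) : Covers n s := by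
  intro x
  obtain ⟨l, hl, hc, hp⟩ := h (e x)
  have key : ∀ (y : G) (a : H), IsConj (e y) a → IsConj y (e.symm a) := fun y a ha => by
    simpa using e.symm.toMonoidHom.map_isConj ha
  refine ⟨l.map e.symm, by simpa using hl, fun a ha => ?_, ?_⟩
  · obtain ⟨b, hb, rfl⟩ := List.mem_map.1 ha
    refine (hc b hb).imp (key s b) fun h => key s⁻¹ b ?_
    rwa [map_inv]
  · rw [← map_list_prod, hp, e.symm_apply_apply]

theorem exists_conj_mul_of_isConj {u s A : G} (h : ∃ g, IsConj u (s * (g * s⁻¹ * g⁻¹)))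
    (hA : IsConj u A) : ∃ a b, IsConj s a ∧ IsConj s⁻¹ b ∧ A = a * b := by
  obtain ⟨g, hg⟩ := h
  obtain ⟨c, hc⟩ := isConj_iff.1 (hg.symm.trans hA)
  exact ⟨c * s * c⁻¹, (c * g) * s⁻¹ * (c * g)⁻¹, isConj_iff.2 ⟨c, rfl⟩,
    isConj_iff.2 ⟨c * g, rfl⟩, by rw [← hc]; group⟩

theorem exists_list_of_isConj_mul {u s A B : G} (h : ∃ g, IsConj u (s * (g * s⁻¹ * g⁻¹)))
    (hA : IsConj u A) (hB : IsConj u B) :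
    ∃ l : List G, l.length = 4 ∧ (∀ a ∈ l, IsConj s a ∨ IsConj s⁻¹ a) ∧ l.prod = A * B := by
  obtain ⟨a, b, ha, hb, rfl⟩ := exists_conj_mul_of_isConj h hA
  obtain ⟨c, d, hc, hd, rfl⟩ := exists_conj_mul_of_isConj h hB
  refine ⟨[a, b, c, d], rfl, ?_, by simp [mul_assoc]⟩
  simp only [List.mem_cons, List.not_mem_nil, or_false, forall_eq_or_imp, forall_eq]
  exact ⟨Or.inl ha, Or.inr hb, Or.inl hc, Or.inr hd⟩

theorem conjWordDiam_le_of_covers {S : Set G} {s : G} (hs : s ∈ S) {n : ℕ} (h : Covers n s) :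
    conjWordDiam S ≤ n := by
  refine iInf₂_le n (Set.eq_univ_of_forall fun x => ?_)
  obtain ⟨l, hl, hc, hp⟩ := h x
  have hlen : (l.length : ℕ∞) ≤ n := by exact_mod_cast hl
  refine le_trans (iInf₂_le (f := fun (l : List G) _ => (l.length : ℕ∞)) l
    ⟨fun a ha => Group.mem_conjugatesOfSet_iff.2 ?_, hp⟩) hlen
  rcases hc a ha with h | h
  · exact ⟨s, Or.inl hs, h⟩
  · exact ⟨s⁻¹, Or.inr (Set.inv_mem_inv.2 hs), h⟩

/-- If the elements outside a proper normal subgroup cover the group in `n` steps, then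
`Δ_∞ ≤ n`. -/
theorem deltaInfty_le_of_covers {n : ℕ} (N : Subgroup G) [N.Normal] (hN : N ≠ ⊤)
    (h : ∀ s ∉ N, Covers n s) : deltaInfty G ≤ ((n : ℕ∞) : WithBot ℕ∞) := by
  refine iSup₂_le fun S hS => ?_
  obtain ⟨s, hs, hsN⟩ : ∃ s ∈ S, s ∉ N := by
    by_contra! H
    exact hN (top_le_iff.1 (hS.2.symm.trans_le (Subgroup.normalClosure_le_normal H)))
  exact WithBot.coe_le_coe.2 (conjWordDiam_le_of_covers hs (h s hsN))

end Covering

section Sign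

/-- The quadratic form over the field with two elements which polarizes to the standard
alternating form and takes the values `a` on the standard basis. -/
def quadForm (a x : V (ZMod 2)) : ZMod 2 :=
  x (.inl 0) * x (.inr 0) + x (.inl 1) * x (.inr 1) + a (.inl 0) * x (.inl 0) +
    a (.inl 1) * x (.inl 1) + a (.inr 0) * x (.inr 0) + a (.inr 1) * x (.inr 1)

/-- The quadratic forms with exactly six zeros, i.e. those of Arf invariant one. -/
abbrev OddForm : Type :=
  {q : V (ZMod 2) → ZMod 2 // (∀ x y, q (x + y) = q x + q y + form x y) ∧
    Nat.card {x // q x = 0} = 6}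

theorem OddForm.exists_eq_quadForm (q : OddForm) : ∃ a, q.1 = quadForm a := by
  obtain ⟨q, hq, -⟩ := q
  refine ⟨vec (q (vec 1 0 0 0)) (q (vec 0 1 0 0)) (q (vec 0 0 1 0)) (q (vec 0 0 0 1)),
    funext fun x => ?_⟩
  have h0 : q 0 = 0 := by simpa [form] using hq 0 0
  have hs : ∀ (k : ZMod 2) (v : V (ZMod 2)), q (k • v) = k * q v := by
    intro k v
    obtain rfl | rfl : k = 0 ∨ k = 1 := by revert k; decide
    · rw [zero_smul, zero_mul, h0]
    · rw [one_smul, one_mul]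
  have hx : x = x (.inl 0) • vec 1 0 0 0 + x (.inl 1) • vec 0 1 0 0 + x (.inr 0) • vec 0 0 1 0 +
      x (.inr 1) • vec 0 0 0 1 := by
    apply vec_ext <;> simp
  conv_lhs => rw [hx]
  simp only [hq, hs, quadForm, form_add_left, form_smul_left, form_smul_right]
  simp [form]
  ring

instance : MulAction (Sp4 (ZMod 2)) OddForm where
  smul g q := ⟨fun x => q.1 (g⁻¹ • x), fun x y => by
    simp only [smul_add, q.2.1, form_smul_smul],
    (Nat.card_congr ((MulAction.toPerm g⁻¹).subtypeEquiv fun _ => Iff.rfl)).trans q.2.2⟩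
  one_smul q := Subtype.ext (funext fun x => by
    change q.1 ((1 : Sp4 (ZMod 2))⁻¹ • x) = _
    rw [inv_one, one_smul])
  mul_smul g h q := Subtype.ext (funext fun x => by
    change q.1 ((g * h)⁻¹ • x) = q.1 (h⁻¹ • g⁻¹ • x)
    rw [_root_.mul_inv_rev, mul_smul])

theorem OddForm.smul_apply (g : Sp4 (ZMod 2)) (q : OddForm) (x : V (ZMod 2)) :
    (g • q).1 x = q.1 (g⁻¹ • x) := rfl

/-- An odd form from its values on the standard basis. -/
def OddForm.mk (a : V (ZMod 2)) (h : Fintype.card {x // quadForm a x = 0} = 6) : OddForm :=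
  ⟨quadForm a, fun x y => by simp only [quadForm, form, Pi.add_apply]; ring, by
    rw [Nat.card_eq_fintype_card, h]⟩

theorem quadForm_transvection : ∀ a x : V (ZMod 2), Fintype.card {y // quadForm a y = 0} = 6 →
    (∀ y, quadForm a y = quadForm (vec 0 1 0 1) y) ∨
      (∀ y, quadForm a y = quadForm (vec 0 1 1 1) y) ∨
        quadForm a (x + form x (vec 1 0 0 0) • vec 1 0 0 0) = quadForm a x := by
  decide +kernel

theorem exists_swap_transvection : ∃ q q' : OddForm, q ≠ q' ∧
    (transvection (vec 1 0 0 0) : Sp4 (ZMod 2)) • q = q' ∧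
      ∀ r : OddForm, r ≠ q → r ≠ q' → (transvection (vec 1 0 0 0) : Sp4 (ZMod 2)) • r = r := by
  refine ⟨.mk (vec 0 1 0 1) (by decide +kernel), .mk (vec 0 1 1 1) (by decide +kernel), ?_, ?_, ?_⟩
  · intro h
    have := congrFun (congrArg Subtype.val h) (vec 0 0 1 0)
    revert this
    decide +kernel
  · refine Subtype.ext (funext fun x => ?_)
    rw [OddForm.smul_apply, transvection_inv, transvection_smul]
    revert x
    decide +kernel
  · intro r h1 h2
    refine Subtype.ext (funext fun x => ?_)
    rw [OddForm.smul_apply, transvection_inv, transvection_smul]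
    obtain ⟨a, ha⟩ := r.exists_eq_quadForm
    have hcard := r.2.2
    rw [ha, Nat.card_eq_fintype_card] at hcard
    rw [ha]
    rcases quadForm_transvection a x hcard with h | h | h
    · exact absurd (Subtype.ext (ha.trans (funext h))) h1
    · exact absurd (Subtype.ext (ha.trans (funext h))) h2
    · exact h

open Classical in
/-- The sign of the permutation of the six odd quadratic forms. -/
noncomputable def signHom : Sp4 (ZMod 2) →* ℤˣ :=
  letI : Fintype OddForm := Fintype.ofFinite _
  Equiv.Perm.sign.comp (MulAction.toPermHom (Sp4 (ZMod 2)) OddForm)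

theorem signHom_transvection {v : V (ZMod 2)} (hv : v ≠ 0) : signHom (transvection v) = -1 := by
  classical
  have h1 : signHom (transvection (vec 1 0 0 0)) = -1 := by
    obtain ⟨q, q', hne, hq, hr⟩ := exists_swap_transvection
    have hq' : (transvection (vec 1 0 0 0) : Sp4 (ZMod 2)) • q' = q := by
      rw [← hq, ← mul_smul, transvection_mul_self, one_smul]
    have hswap : MulAction.toPermHom (Sp4 (ZMod 2)) OddForm (transvection (vec 1 0 0 0)) =
        Equiv.swap q q' := by
      refine Equiv.ext fun r => ?_
      rw [MulAction.toPermHom_apply, MulAction.toPerm_apply]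
      by_cases hrq : r = q
      · rw [hrq, Equiv.swap_apply_left, hq]
      by_cases hrq' : r = q'
      · rw [hrq', Equiv.swap_apply_right, hq']
      rw [Equiv.swap_apply_of_ne_of_ne hrq hrq', hr r hrq hrq']
    rw [signHom, MonoidHom.comp_apply, hswap]
    convert Equiv.Perm.sign_swap hne
  obtain ⟨w, hw⟩ := exists_form_eq_one hv
  obtain ⟨q, s, hb⟩ := exists_isBasis hw
  obtain ⟨g, hg⟩ := hb.exists_smul
  have hg1 : g • vec 1 0 0 0 = v := by simpa using hg 1 0 0 0
  rw [← hg1, ← conj_transvection, map_mul, map_mul, map_inv, h1, mul_comm, inv_mul_cancel_left]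

end Sign

section Final

/-- The symplectic groups of isomorphic rings are isomorphic. -/
def sp4Congr {R R' : Type*} [CommRing R] [CommRing R'] (e : R ≃+* R') : Sp4 R ≃* Sp4 R' where
  toFun A := ⟨_, SymplecticGroup.map_mem A.2 e⟩
  invFun A := ⟨_, SymplecticGroup.map_mem A.2 e.symm⟩
  left_inv A := Subtype.ext (by ext; simp)
  right_inv A := Subtype.ext (by ext; simp)
  map_mul' A B := Subtype.ext (by
    ext i j
    exact congrFun (congrFun (Matrix.map_mul (f := e)) i) j)

theorem covers_F4 {s : Sp4 F4} (hs : s ≠ 1) : Covers 4 s := by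
  intro X
  have he : ∀ k, k ∈ F4.elts := by decide
  have hsq : ∀ c : F4, ∃ d, d * d = c := by decide
  have hcomm := isConj_commutator_of_search hsq (search_of_checkSearch he checkSearch_F4) hs
  obtain ⟨g, t, A, B, ht, hA, hB, rfl⟩ := isFactored_of_checkTable hsq he (by rfl) checkTable_F4 X
  rw [of_decide_eq_true ht, Tup.toV_zero, smul_zero, transvection_zero, one_mul]
  obtain ⟨l, hl, hc, hp⟩ := exists_list_of_isConj_mul hcomm hA hB
  exact ⟨l, hl.le, hc, hp⟩

theorem exists_isConj_of_signHom_eq_one {X : Sp4 (ZMod 2)} (hX : signHom X = 1) :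
    ∃ A B, IsConj (refInvolution (ZMod 2)) A ∧ IsConj (refInvolution (ZMod 2)) B ∧ X = A * B := by
  have he : ∀ k : ZMod 2, k ∈ [0, 1] := by decide
  have hsq : ∀ c : ZMod 2, ∃ d, d * d = c := by decide
  obtain ⟨g, t, A, B, -, hA, hB, rfl⟩ :=
    isFactored_of_checkTable hsq he (by rfl) checkTable_zmod_two X
  have key : ∀ C, IsConj (refInvolution (ZMod 2)) C → signHom C = 1 := by
    intro C hC
    rw [← isConj_iff_eq.1 (signHom.map_isConj hC), refInvolution, map_mul, signHom_transvection,
      signHom_transvection, neg_mul_neg, one_mul]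
    · exact fun h => one_ne_zero (congrFun h (.inl 1))
    · exact fun h => one_ne_zero (congrFun h (.inl 0))
  rw [map_mul, map_mul, key A hA, key B hB, one_mul, mul_one] at hX
  by_cases ht : g • t.toV = 0
  · exact ⟨A, B, hA, hB, by rw [ht, transvection_zero, one_mul]⟩
  · rw [signHom_transvection ht] at hX
    exact absurd hX (by decide)

theorem covers_zmod_two {s : Sp4 (ZMod 2)} (hs : signHom s ≠ 1) : Covers 5 s := by
  intro X
  have he : ∀ k : ZMod 2, k ∈ [0, 1] := by decide
  have hsq : ∀ c : ZMod 2, ∃ d, d * d = c := by decide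
  have hcomm := isConj_commutator_of_search hsq (search_of_checkSearch he checkSearch_zmod_two)
    (X := s) (by rintro rfl; exact hs (map_one _))
  by_cases hX : signHom X = 1
  · obtain ⟨A, B, hA, hB, rfl⟩ := exists_isConj_of_signHom_eq_one hX
    obtain ⟨l, hl, hc, hp⟩ := exists_list_of_isConj_mul hcomm hA hB
    exact ⟨l, by omega, hc, hp⟩
  · have h1 : signHom (s⁻¹ * X) = 1 := by
      rw [map_mul, map_inv, (Int.units_eq_one_or _).resolve_left hX,
        (Int.units_eq_one_or _).resolve_left hs, inv_mul_cancel]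
    obtain ⟨A, B, hA, hB, hAB⟩ := exists_isConj_of_signHom_eq_one h1
    obtain ⟨l, hl, hc, hp⟩ := exists_list_of_isConj_mul hcomm hA hB
    refine ⟨s :: l, by simp [hl], fun a ha => ?_, ?_⟩
    · rcases List.mem_cons.1 ha with rfl | ha
      · exact Or.inl (IsConj.refl _)
      · exact hc a ha
    · rw [List.prod_cons, hp, ← hAB, mul_inv_cancel_left]

theorem deltaInfty_sp4_zmod_two {K : Type*} [Field K] (e : K ≃+* ZMod 2) :
    deltaInfty (Sp4 K) ≤ 5 := by
  refine deltaInfty_le_of_covers (n := 5) (signHom.comp (sp4Congr e).toMonoidHom).ker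
    (fun h => ?_) fun s hs => Covers.of_mulEquiv (sp4Congr e) (covers_zmod_two hs)
  have h1 : (sp4Congr e).symm (transvection (vec 1 0 0 0)) ∈
      (signHom.comp (sp4Congr e).toMonoidHom).ker := h ▸ Subgroup.mem_top _
  have h2 : signHom (transvection (vec 1 0 0 0)) = 1 := by simpa [MonoidHom.mem_ker] using h1
  rw [signHom_transvection fun h => one_ne_zero (congrFun h (.inl 0))] at h2
  exact absurd h2 (by decide)

theorem deltaInfty_sp4_F4 {K : Type*} [Field K] (e : K ≃+* F4) : deltaInfty (Sp4 K) ≤ 4 := by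
  refine deltaInfty_le_of_covers (n := 4) ⊥ (fun h => ?_) fun s hs =>
    Covers.of_mulEquiv (sp4Congr e) (covers_F4 fun h1 => hs ?_)
  · have h1 : (sp4Congr e).symm (transvection (vec 1 0 0 0)) ∈ (⊥ : Subgroup (Sp4 K)) :=
      h ▸ Subgroup.mem_top _
    rw [Subgroup.mem_bot, EmbeddingLike.map_eq_one_iff] at h1
    have h2 := congrArg (· • (vec 0 0 1 0 : V F4)) h1
    simp only [transvection_smul, one_smul] at h2
    have h3 := congrFun h2 (.inl 0)
    revert h3
    decide
  · rw [Subgroup.mem_bot]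
    exact (EmbeddingLike.map_eq_one_iff (f := sp4Congr e)).1 h1

end Final
end Symp4

theorem mainTheorem8 (K : Type*) [Field K] :
    (Nat.card K = 2 → deltaInfty (Sp4 K) ≤ 5) ∧
    (Nat.card K = 4 → deltaInfty (Sp4 K) ≤ 4) := by
  constructor
  · intro h
    have : Finite K := Nat.finite_of_card_ne_zero (by omega)
    have := Fintype.ofFinite K
    exact Symp4.deltaInfty_sp4_zmod_two (FiniteField.ringEquivOfCardEq (by
      rw [← Nat.card_eq_fintype_card, h, ZMod.card]))
  · intro h
    have : Finite K := Nat.finite_of_card_ne_zero (by omega)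
    have := Fintype.ofFinite K
    exact Symp4.deltaInfty_sp4_F4 (FiniteField.ringEquivOfCardEq (by
      rw [← Nat.card_eq_fintype_card, h]; rfl))
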